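/- There are $N$ users and $K=bN$ channels, where $b\ge 1$ is a fixed integer. Let $g_{n,k}$ be the (random, real-valued) gain of channel $k$ for user $n$: for each user $n$ the gains $g_{n,1},\dots,g_{n,K}$ are i.i.d., and the gain vectors of different users are independent (different users may have different gain distributions). Channel $k$ is one of the $M$ best channels of user $n$ if fewer than $M$ channels $j$ satisfy $g_{n,j}>g_{n,k}$. The user-channel graph is the bipartite graph with $b$ agent vertices for each user on one side and the $K$ channels on the other, in which every agent of user $n$ is joined exactly to the $M$ best channels of user $n$. Let $\mathcal E_K$ be the event that this graph has no perfect matching, i.e. that there is no allocation in which each user gets $b$ channels, all of them among his $M$ best. Let $\varepsilon>0$. (1) There is a $K_0$, depending only on $b$ and $\varepsilon$, such that for all $K=bN\ge K_0$ and all integers $M\ge (b+1)(1+\varepsilon)\ln K$, $$\Pr(\mathcal E_K)\le \frac{1}{K^{\varepsilon+\frac{\varepsilon+1}{b}}}+\frac{\pi\sqrt b\,e^3}{12}\cdot\frac{1}{K^{\frac32\varepsilon+\frac{\frac32\varepsilon+1}{b}}}.$$ (2) Consequently, if $M=M_K$ satisfies $M_K\ge (b+1)(1+\varepsilon)\ln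 K$ for all large $K=bN$, then $\Pr(\mathcal E_K)\to 0$ as $N\to\infty$, that is, a perfect matching exists with probability tending to $1$. (3) If moreover $\varepsilon\ge 1$, and the gains for all $N$ are defined on one probability space (with any joint dependence between different values of $N$), then the indicator of $\mathcal E_K$ converges to $0$ almost surely as $N\to\infty$. -/

import Mathlib

open MeasureTheory ProbabilityTheory Filter Topology

/-- Channel `k` is one of the `M` best channels for a user whose vector of channel gains is `x`:
fewer than `M` channels have a strictly larger gain. When the gains are pairwise distinct there
are exactly `min M K` such channels; equal gains are ranked equally. -/
def IsAmongBest {K : ℕ} (M : ℕ) (x : Fin K → ℝ) (k : Fin K) : Prop :=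
  (Finset.univ.filter (fun j : Fin K => x k < x j)).card < M

/-- The user-channel graph for `N` users and `K = b * N` channels: each user `n` has `b` user nodes
("agents") `(n, i)`, each channel has one node, and agent `(n, i)` is joined to channel `k` if and
only if `k` is one of the `M` best channels of user `n`. The matrix `x` holds the channel gains. -/
def userChannelGraph (b N M : ℕ) (x : Fin N → Fin (b * N) → ℝ) :
    SimpleGraph ((Fin N × Fin b) ⊕ Fin (b * N)) where
  Adj u v :=
    match u, v with
    | Sum.inl a, Sum.inr k => IsAmongBest M (x a.1) k
    | Sum.inr k, Sum.inl a => IsAmongBest M (x a.1) k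
    | _, _ => False
  symm := ⟨by rintro (a | k) (a' | k') h <;> exact h⟩
  loopless := ⟨by rintro (a | k) h <;> exact h⟩

/-- The user-channel graph has a perfect matching, that is, the channels can be allocated so that
each user gets `b` channels, all of them among his `M` best. -/
def HasPM (b N M : ℕ) (x : Fin N → Fin (b * N) → ℝ) : Prop :=
  ∃ P : (userChannelGraph b N M x).Subgraph, P.IsPerfectMatching

/-- The event that no perfect matching exists, for the random channel gains `g n k`. -/
def noPMEvent {Ω : Type*} (b N M : ℕ) (g : Fin N → Fin (b * N) → Ω → ℝ) : Set Ω :=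
  {ω | ¬ HasPM b N M (fun n k => g n k ω)}

/-- The assumptions on the channel gains `g n k` of `N` users in `K` channels: the gains of each
user are i.i.d. random variables, and the gain vectors of the different users are independent.
Different users may have different gain distributions. -/
structure IsChannelGains {Ω : Type*} [MeasurableSpace Ω] (μ : Measure Ω) {N K : ℕ}
    (g : Fin N → Fin K → Ω → ℝ) : Prop where
  measurable : ∀ n k, Measurable (g n k)
  identDistrib : ∀ n k k', IdentDistrib (g n k) (g n k') μ μ
  indep_channels : ∀ n, iIndepFun (fun k => g n k) μ
  indep_users : iIndepFun (fun (n : Fin N) (ω : Ω) (k : Fin K) => g n k ω) μ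

/-! ### Counting, ties, and Hall's theorem. -/

section Combinatorics

/-! By Hall's theorem, failure of a perfect matching yields `a` users whose best channels all lie in
a set of `b * a - 1` channels (`exists_hall_violator_of_not_hasPM`). A union bound over these
configurations controls the probability.

For one user and a fixed `T` with `t < K` elements, exchangeability makes the probability that `T`
contains all best channels depend on `t` only. Averaging over all `t`-sets, and using that at least
`M` channels are best when `M ≤ K`, bounds it by `(K-M).choose (t-M) / K.choose t ≤ (t/K)^M`. Ties
only enlarge the best set, so no continuity of the gains is needed. Independence of users raises the
bound to the power `a`.

In the resulting sum (`exists_forall_sum_hallTerm_le`) the term `a = N`, a single channel wanted by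
nobody, is the leading one. With `P` the second exponent in the bound, the terms `a < N` together
cost at most `3 K^(-P)`: small and middle `a` are each at most `K^(-P-1)`, and for `a` near `N` the
terms decay geometrically in `N - a`. The limit statements follow by squeezing and by
Borel–Cantelli. -/

lemma choose_sub_mul_pow_le (n t m : ℕ) (htn : t ≤ n) (hmt : m ≤ t) :
    (n - m).choose (t - m) * n ^ m ≤ n.choose t * t ^ m := by
  induction m with
  | zero => simp
  | succ m ih =>
    have ih := ih (by omega)
    obtain ⟨u, rfl⟩ : ∃ u, t = m + 1 + u := ⟨t - (m + 1), by omega⟩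
    obtain ⟨v, rfl⟩ : ∃ v, n = m + 1 + v := ⟨n - (m + 1), by omega⟩
    have e1 : m + 1 + v - (m + 1) = v := by omega
    have e2 : m + 1 + u - (m + 1) = u := by omega
    have e3 : m + 1 + v - m = v + 1 := by omega
    have e4 : m + 1 + u - m = u + 1 := by omega
    rw [e1, e2]
    rw [e3, e4] at ih
    have h := Nat.add_one_mul_choose_eq v u
    have huv : u ≤ v := by omega
    -- Each induction step multiplies the ratio of binomials by `(t-m)/(n-m)`, which is at most
    -- `t/n`.
    have hcross : (u + 1) * (m + 1 + v) ≤ (m + 1 + u) * (v + 1) := by nlinarith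
    have hpos : 0 < v + 1 := by omega
    refine Nat.le_of_mul_le_mul_left ?_ hpos
    calc (v + 1) * (v.choose u * (m + 1 + v) ^ (m + 1))
        = ((v + 1) * v.choose u) * (m + 1 + v) ^ m * (m + 1 + v) := by ring
      _ = ((v + 1).choose (u + 1) * (m + 1 + v) ^ m) * ((u + 1) * (m + 1 + v)) := by
          rw [h]; ring
      _ ≤ ((m + 1 + v).choose (m + 1 + u) * (m + 1 + u) ^ m) * ((m + 1 + u) * (v + 1)) :=
          Nat.mul_le_mul ih hcross
      _ = _ := by ring

lemma card_powersetCard_filter_superset_le {α : Type*} [Fintype α] [DecidableEq α]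
    (S : Finset α) (t : ℕ) :
    ((Finset.univ.powersetCard t).filter (fun T : Finset α => S ⊆ T)).card
      ≤ (Fintype.card α - S.card).choose (t - S.card) := by
  have : (Fintype.card α - S.card).choose (t - S.card)
      = ((Finset.univ \ S).powersetCard (t - S.card)).card := by
    rw [Finset.card_powersetCard, Finset.card_sdiff_of_subset (Finset.subset_univ S),
      Finset.card_univ]
  rw [this]
  refine Finset.card_le_card_of_injOn (fun T => T \ S) ?_ ?_
  · intro T hT
    simp only [Finset.coe_filter, Finset.mem_powersetCard, Set.mem_ofPred_eq] at hT
    simp only [Finset.mem_coe, Finset.mem_powersetCard]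
    refine ⟨Finset.sdiff_subset_sdiff (Finset.subset_univ _) le_rfl, ?_⟩
    rw [Finset.card_sdiff_of_subset hT.2, hT.1.2]
  · intro T hT T' hT' h
    simp only [Finset.coe_filter, Set.mem_ofPred_eq] at hT hT'
    have h' : T \ S = T' \ S := h
    rw [← Finset.sdiff_union_of_subset hT.2, h', Finset.sdiff_union_of_subset hT'.2]

open Classical in
-- If fewer than `M` channels were best, a channel of largest gain among the others would be beaten
-- only by best ones, hence by fewer than `M`, and so be best itself.
lemma le_card_isAmongBest {K M : ℕ} (hMK : M ≤ K) (x : Fin K → ℝ) :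
    M ≤ (Finset.univ.filter (IsAmongBest M x)).card := by
  by_contra! h
  set S := Finset.univ.filter (IsAmongBest M x) with hS
  have hne : Sᶜ.Nonempty := by
    rw [← Finset.card_pos, Finset.card_compl, Fintype.card_fin]
    omega
  obtain ⟨k, hk, hmax⟩ := Finset.exists_max_image Sᶜ x hne
  have hsub : Finset.univ.filter (fun j : Fin K => x k < x j) ⊆ S := by
    intro j hj
    by_contra hjS
    exact absurd (Finset.mem_filter.1 hj).2 (not_lt.2 (hmax j (Finset.mem_compl.2 hjS)))
  refine (Finset.mem_compl.1 hk) ?_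
  rw [hS, Finset.mem_filter]
  refine ⟨Finset.mem_univ _, ?_⟩
  unfold IsAmongBest
  refine lt_of_le_of_lt (Finset.card_le_card ?_) h
  convert hsub

lemma isAmongBest_comp_equiv {K M : ℕ} (x : Fin K → ℝ) (σ : Equiv.Perm (Fin K)) (k : Fin K) :
    IsAmongBest M (x ∘ σ) k ↔ IsAmongBest M x (σ k) := by
  unfold IsAmongBest
  have : (Finset.univ.filter (fun j : Fin K => x (σ k) < x j))
      = (Finset.univ.filter (fun j : Fin K => (x ∘ σ) k < (x ∘ σ) j)).map σ.toEmbedding := by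
    ext j
    simp only [Finset.mem_filter, Finset.mem_univ, true_and, Finset.mem_map,
      Equiv.coe_toEmbedding, Function.comp_apply]
    exact ⟨fun h => ⟨σ.symm j, by simpa using h, by simp⟩, by rintro ⟨a, h, rfl⟩; exact h⟩
  rw [this, Finset.card_map]

/-- Agents and channels are equally many, so an injection of agents also covers every channel. -/
lemma hasPM_of_injective {b N M : ℕ} {x : Fin N → Fin (b * N) → ℝ}
    (f : Fin N × Fin b → Fin (b * N)) (hf : Function.Injective f)
    (h : ∀ a, IsAmongBest M (x a.1) (f a)) : HasPM b N M x := by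
  have hbij : Function.Bijective f :=
    (Fintype.bijective_iff_injective_and_card f).2 ⟨hf, by simp [mul_comm]⟩
  refine ⟨
    { verts := Set.univ
      Adj := fun u v => match u, v with
        | Sum.inl a, Sum.inr k => f a = k
        | Sum.inr k, Sum.inl a => f a = k
        | _, _ => False
      adj_sub := ?_
      edge_vert := fun _ => Set.mem_univ _
      symm := ⟨?_⟩ }, ?_, ?_⟩
  · rintro (a | k) (a' | k') hh
    · exact hh
    · change f a = k' at hh
      subst hh
      exact h a
    · change f a' = k at hh
      subst hh
      exact h a'
    · exact hh
  · rintro (a | k) (a' | k') hh <;> exact hh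
  · rintro (a | k) -
    · refine ⟨Sum.inr (f a), rfl, ?_⟩
      rintro (a' | k') hh
      · exact hh.elim
      · exact congrArg Sum.inr (Eq.symm hh)
    · obtain ⟨a, rfl⟩ := hbij.2 k
      refine ⟨Sum.inl a, rfl, ?_⟩
      rintro (a' | k') hh
      · exact congrArg Sum.inl (hf hh)
      · exact hh.elim
  · exact fun v => Set.mem_univ v

lemma exists_hall_violator_of_not_hasPM {b N M : ℕ} {x : Fin N → Fin (b * N) → ℝ}
    (h : ¬ HasPM b N M x) :
    ∃ A : Finset (Fin N), A.Nonempty ∧ ∃ T : Finset (Fin (b * N)),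
      T.card = b * A.card - 1 ∧ ∀ n ∈ A, ∀ k, IsAmongBest M (x n) k → k ∈ T := by
  classical
  by_contra! hcon
  apply h
  obtain ⟨f, hf, hf'⟩ := (Finset.all_card_le_biUnion_card_iff_exists_injective
    (fun a : Fin N × Fin b => Finset.univ.filter (IsAmongBest M (x a.1)))).1 (by
      intro s
      by_contra! hs
      set U := s.biUnion (fun a : Fin N × Fin b =>
        Finset.univ.filter (IsAmongBest M (x a.1))) with hU
      have hsne : s.Nonempty := Finset.card_pos.1 (by omega)
      have hsA : s.card ≤ b * (s.image Prod.fst).card := by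
        refine (Finset.card_le_card (t := s.image Prod.fst ×ˢ Finset.univ) ?_).trans ?_
        · intro a ha
          exact Finset.mem_product.2 ⟨Finset.mem_image_of_mem _ ha, Finset.mem_univ _⟩
        · rw [Finset.card_product]
          simp [mul_comm]
      have hAN : (s.image Prod.fst).card ≤ N := by
        simpa using Finset.card_le_univ (s.image Prod.fst)
      have hle : b * (s.image Prod.fst).card ≤ b * N := Nat.mul_le_mul_left _ hAN
      -- A violating set of agents has at most `b * |A|` members, `A` being its users, so its
      -- neighbourhood has at most `b * |A| - 1` channels. Padding to exactly that size leaves one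
      -- size of `T` for each `|A|`.
      obtain ⟨T, hUT, -, hT⟩ := Finset.exists_subsuperset_card_eq (Finset.subset_univ U)
        (n := b * (s.image Prod.fst).card - 1) (by omega) (by simp; omega)
      obtain ⟨n, hn, k, hk, hkT⟩ := hcon _ (hsne.image _) T hT
      obtain ⟨a, ha, rfl⟩ := Finset.mem_image.1 hn
      exact hkT (hUT (Finset.mem_biUnion.2
        ⟨a, ha, Finset.mem_filter.2 ⟨Finset.mem_univ _, hk⟩⟩)))
  exact hasPM_of_injective f hf fun a => (Finset.mem_filter.1 (hf' a)).2

end Combinatorics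

/-! ### Exchangeability and the union bound. -/

section Probability

variable {Ω : Type*} [MeasurableSpace Ω] {μ : Measure Ω} [IsProbabilityMeasure μ]

lemma measurableSet_isAmongBest_subset {K : ℕ} (M : ℕ) (T : Finset (Fin K)) :
    MeasurableSet {x : Fin K → ℝ | ∀ k, IsAmongBest M x k → k ∈ T} := by
  classical
  have hk : ∀ k, MeasurableSet {x : Fin K → ℝ | IsAmongBest M x k} := by
    intro k
    have : {x : Fin K → ℝ | IsAmongBest M x k}
        = {x | ∑ j : Fin K, (if x k < x j then 1 else 0) < M} := by
      ext x
      simp [IsAmongBest]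
    rw [this]
    refine measurableSet_lt ?_ measurable_const
    refine Finset.measurable_sum _ fun j _ => ?_
    exact Measurable.ite (measurableSet_lt (measurable_pi_apply k) (measurable_pi_apply j))
      measurable_const measurable_const
  simp only [Set.ofPred_forall]
  refine MeasurableSet.iInter fun k => ?_
  by_cases hkT : k ∈ T
  · simp [hkT]
  · have : {x : Fin K → ℝ | IsAmongBest M x k → k ∈ T} = {x | IsAmongBest M x k}ᶜ := by
      ext x
      simp [hkT]
    rw [this]
    exact (hk k).compl

/-- Both joint laws are products of marginals, and the marginals all coincide. -/
lemma map_comp_perm_of_iIndepFun_identDistrib {K : ℕ} {X : Fin K → Ω → ℝ}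
    (hm : ∀ k, Measurable (X k)) (hid : ∀ k k', IdentDistrib (X k) (X k') μ μ)
    (hind : iIndepFun X μ) (σ : Equiv.Perm (Fin K)) :
    μ.map (fun ω k => X (σ k) ω) = μ.map (fun ω k => X k ω) := by
  rw [(iIndepFun_iff_map_fun_eq_pi_map (fun k => (hm k).aemeasurable)).1 hind,
    (iIndepFun_iff_map_fun_eq_pi_map (f := fun k => X (σ k))
      (fun k => (hm (σ k)).aemeasurable)).1 (hind.precomp σ.injective)]
  congr 1
  funext k
  exact (hid (σ k) k).map_eq

lemma measureReal_best_subset_eq {K : ℕ} {X : Fin K → Ω → ℝ}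
    (hm : ∀ k, Measurable (X k)) (hid : ∀ k k', IdentDistrib (X k) (X k') μ μ)
    (hind : iIndepFun X μ) (M : ℕ) {T T' : Finset (Fin K)} (hTT' : T.card = T'.card) :
    μ.real {ω | ∀ k, IsAmongBest M (fun j => X j ω) k → k ∈ T}
      = μ.real {ω | ∀ k, IsAmongBest M (fun j => X j ω) k → k ∈ T'} := by
  obtain ⟨σ, hσ⟩ : ∃ σ : Equiv.Perm (Fin K), ∀ k, k ∈ T ↔ σ k ∈ T' := by
    let e : {k // k ∈ T} ≃ {k // k ∈ T'} := Fintype.equivOfCardEq (by simpa using hTT')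
    refine ⟨e.extendSubtype, fun k => ⟨fun h => e.extendSubtype_mem k h, fun h => ?_⟩⟩
    by_contra hk
    exact e.extendSubtype_not_mem k hk h
  have hmeas : Measurable (fun ω k => X k ω) := measurable_pi_lambda _ hm
  have hmeas' : Measurable (fun ω k => X (σ k) ω) := measurable_pi_lambda _ fun k => hm (σ k)
  have hT := measurableSet_isAmongBest_subset M T
  have key := congrArg (fun ν => ν.real {x | ∀ k, IsAmongBest M x k → k ∈ T})
    (map_comp_perm_of_iIndepFun_identDistrib hm hid hind σ)
  simp only [map_measureReal_apply hmeas hT, map_measureReal_apply hmeas' hT] at key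
  refine Eq.trans key.symm ?_
  congr 1
  ext ω
  simp only [Set.mem_preimage, Set.mem_ofPred_eq]
  have h1 : ∀ k, IsAmongBest M (fun k => X (σ k) ω) k ↔ IsAmongBest M (fun k => X k ω) (σ k) :=
    fun k => isAmongBest_comp_equiv (fun k => X k ω) σ k
  simp only [h1, hσ]
  exact σ.forall_congr_left.trans (by simp)

/-- Double counting: all `t`-sets are equally likely to contain the best channels, and for each
outcome at most `(K-M).choose (t-M)` of them do. -/
lemma measureReal_best_subset_le {K : ℕ} {X : Fin K → Ω → ℝ}
    (hm : ∀ k, Measurable (X k)) (hid : ∀ k k', IdentDistrib (X k) (X k') μ μ)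
    (hind : iIndepFun X μ) (M : ℕ) {T : Finset (Fin K)} (hT : T.card < K) :
    μ.real {ω | ∀ k, IsAmongBest M (fun j => X j ω) k → k ∈ T}
      ≤ ((T.card : ℝ) / K) ^ M := by
  classical
  -- Degenerate cases where the event is impossible: if `M > K` every channel is best, and otherwise
  -- at least `M` channels are best, too many for `T`.
  have hempty : K < M ∨ (M ≤ K ∧ T.card < M) →
      μ.real {ω | ∀ k, IsAmongBest M (fun j => X j ω) k → k ∈ T}
      ≤ ((T.card : ℝ) / K) ^ M := by
    intro h
    have : {ω | ∀ k, IsAmongBest M (fun j => X j ω) k → k ∈ T} = ∅ := by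
      refine Set.eq_empty_of_forall_notMem fun ω hω => ?_
      have hsub : Finset.univ.filter (IsAmongBest M (fun j => X j ω)) ⊆ T := fun k hk =>
        hω k (Finset.mem_filter.1 hk).2
      have hle := Finset.card_le_card hsub
      rcases h with h | h
      · have : Finset.univ.filter (IsAmongBest M (fun j => X j ω)) = Finset.univ := by
          refine Finset.filter_true_of_mem fun k _ => ?_
          unfold IsAmongBest
          exact lt_of_le_of_lt (Finset.card_le_univ _) (by simpa using h)
        rw [this, Finset.card_univ, Fintype.card_fin] at hle
        omega
      · have := le_card_isAmongBest h.1 (fun j => X j ω)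
        omega
    rw [this, measureReal_empty]
    positivity
  by_cases h1 : K < M
  · exact hempty (Or.inl h1)
  by_cases h2 : T.card < M
  · exact hempty (Or.inr ⟨by omega, h2⟩)
  push Not at h1 h2
  set t := T.card with ht
  let E : Finset (Fin K) → Set Ω := fun T' => {ω | ∀ k, IsAmongBest M (fun j => X j ω) k → k ∈ T'}
  have hE : ∀ T', MeasurableSet (E T') := fun T' =>
    (measurable_pi_lambda (fun ω k => X k ω) hm) (measurableSet_isAmongBest_subset M T')
  have hsum : ∑ T' ∈ Finset.univ.powersetCard t, μ.real (E T')
      ≤ ((K - M).choose (t - M) : ℕ) := by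
    calc ∑ T' ∈ Finset.univ.powersetCard t, μ.real (E T')
        = ∑ T' ∈ Finset.univ.powersetCard t, ∫ ω, (E T').indicator (fun _ => (1 : ℝ)) ω ∂μ := by
          refine Finset.sum_congr rfl fun T' _ => ?_
          rw [integral_indicator_const _ (hE T')]
          simp
      _ = ∫ ω, ∑ T' ∈ Finset.univ.powersetCard t, (E T').indicator (fun _ => (1 : ℝ)) ω ∂μ := by
          rw [integral_finsetSum]
          intro T' _
          exact (integrable_const (1 : ℝ)).indicator (hE T')
      _ ≤ ∫ _, (((K - M).choose (t - M) : ℕ) : ℝ) ∂μ := by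
          refine integral_mono (integrable_finsetSum _ fun T' _ =>
            (integrable_const (1 : ℝ)).indicator (hE T')) (integrable_const _) fun ω => ?_
          -- Ties may make the best set larger than `M`; a subset of exactly `M` suffices for the
          -- count.
          obtain ⟨S, hS, hSM⟩ := Finset.exists_subset_card_eq
            (le_card_isAmongBest h1 (fun j => X j ω))
          have hcard := card_powersetCard_filter_superset_le S t
          rw [hSM, Fintype.card_fin] at hcard
          calc ∑ T' ∈ Finset.univ.powersetCard t, (E T').indicator (fun _ => (1 : ℝ)) ω
              ≤ ∑ T' ∈ Finset.univ.powersetCard t, (if S ⊆ T' then (1 : ℝ) else 0) := by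
                refine Finset.sum_le_sum fun T' _ => ?_
                by_cases hω : ω ∈ E T'
                · have : S ⊆ T' := fun k hk => hω k (Finset.mem_filter.1 (hS hk)).2
                  simp [hω, this]
                · rw [Set.indicator_of_notMem hω]
                  positivity
            _ = (((Finset.univ.powersetCard t).filter
                  (fun T' : Finset (Fin K) => S ⊆ T')).card : ℝ) := by
                rw [Finset.sum_boole]
            _ ≤ _ := by exact_mod_cast hcard
      _ = _ := by simp
  have hconst : ∑ T' ∈ Finset.univ.powersetCard t, μ.real (E T')
      = (K.choose t : ℝ) * μ.real (E T) := by
    rw [Finset.sum_congr rfl (g := fun _ => μ.real (E T)) fun T' hT' =>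
      measureReal_best_subset_eq hm hid hind M ((Finset.mem_powersetCard.1 hT').2.trans ht)]
    simp
  have hchoose : (((K - M).choose (t - M) : ℕ) : ℝ) * (K : ℝ) ^ M ≤ K.choose t * (t : ℝ) ^ M := by
    exact_mod_cast choose_sub_mul_pow_le K t M hT.le h2
  have hKpos : (0 : ℝ) < K := by exact_mod_cast (by omega : 0 < K)
  have hCpos : (0 : ℝ) < K.choose t := by exact_mod_cast Nat.choose_pos hT.le
  rw [hconst] at hsum
  change μ.real (E T) ≤ _
  rw [div_pow, le_div_iff₀ (by positivity)]
  refine le_of_mul_le_mul_left ?_ hCpos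
  calc (K.choose t : ℝ) * (μ.real (E T) * (K : ℝ) ^ M)
      = (K.choose t * μ.real (E T)) * (K : ℝ) ^ M := by ring
    _ ≤ ((K - M).choose (t - M) : ℕ) * (K : ℝ) ^ M := by gcongr
    _ ≤ _ := hchoose

lemma measureReal_forall_best_subset_le {N K : ℕ} {g : Fin N → Fin K → Ω → ℝ}
    (hg : IsChannelGains μ g) (M : ℕ) (A : Finset (Fin N)) {T : Finset (Fin K)}
    (hT : T.card < K) :
    μ.real {ω | ∀ n ∈ A, ∀ k, IsAmongBest M (fun j => g n j ω) k → k ∈ T}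
      ≤ ((T.card : ℝ) / K) ^ (A.card * M) := by
  have hset : {ω | ∀ n ∈ A, ∀ k, IsAmongBest M (fun j => g n j ω) k → k ∈ T}
      = ⋂ n ∈ A, (fun ω j => g n j ω) ⁻¹' {x | ∀ k, IsAmongBest M x k → k ∈ T} := by
    ext ω
    simp
  rw [hset, measureReal_def, hg.indep_users.meas_biInter (fun n _ =>
    ⟨_, measurableSet_isAmongBest_subset M T, rfl⟩), ENNReal.toReal_prod, mul_comm, pow_mul,
    ← Finset.prod_const]
  exact Finset.prod_le_prod (fun _ _ => ENNReal.toReal_nonneg) fun n _ =>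
    measureReal_best_subset_le (hg.measurable n) (hg.identDistrib n) (hg.indep_channels n) M hT

lemma measureReal_noPMEvent_le {b N : ℕ} (hb : 1 ≤ b) (M : ℕ)
    {g : Fin N → Fin (b * N) → Ω → ℝ} (hg : IsChannelGains μ g) :
    μ.real (noPMEvent b N M g) ≤ ∑ a ∈ Finset.Icc 1 N,
      (N.choose a : ℝ) * ((b * N).choose (b * a - 1)) *
        (((b * a - 1 : ℕ) : ℝ) / ((b * N : ℕ) : ℝ)) ^ (a * M) := by
  classical
  let E : Finset (Fin N) → Finset (Fin (b * N)) → Set Ω := fun A T =>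
    {ω | ∀ n ∈ A, ∀ k, IsAmongBest M (fun j => g n j ω) k → k ∈ T}
  let 𝒯 : ℕ → Finset (Finset (Fin (b * N))) := fun a => Finset.univ.powersetCard (b * a - 1)
  have hsub : noPMEvent b N M g ⊆ ⋃ a ∈ Finset.Icc 1 N,
      ⋃ A ∈ (Finset.univ : Finset (Fin N)).powersetCard a, ⋃ T ∈ 𝒯 a, E A T := by
    intro ω hω
    obtain ⟨A, hA, T, hT, h⟩ := exists_hall_violator_of_not_hasPM hω
    simp only [Set.mem_iUnion]
    refine ⟨A.card, Finset.mem_Icc.2 ⟨hA.card_pos, by simpa using Finset.card_le_univ A⟩, A,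
      by simp, T, by simp [𝒯, hT], h⟩
  refine (measureReal_mono hsub (measure_ne_top μ _)).trans ((measureReal_biUnion_finset_le _ _).trans ?_)
  refine Finset.sum_le_sum fun a ha => ?_
  obtain ⟨ha1, haN⟩ := Finset.mem_Icc.1 ha
  refine (measureReal_biUnion_finset_le _ _).trans ?_
  have hlt : b * a - 1 < b * N := by
    have : b * a ≤ b * N := Nat.mul_le_mul_left _ haN
    have : 0 < b * a := Nat.mul_pos hb ha1
    omega
  have hA : ∀ A ∈ (Finset.univ : Finset (Fin N)).powersetCard a, μ.real (⋃ T ∈ 𝒯 a, E A T)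
      ≤ ((b * N).choose (b * a - 1)) *
        (((b * a - 1 : ℕ) : ℝ) / ((b * N : ℕ) : ℝ)) ^ (a * M) := by
    intro A hA
    refine (measureReal_biUnion_finset_le _ _).trans ?_
    refine (Finset.sum_le_card_nsmul _ _ ((((b * a - 1 : ℕ) : ℝ) / ((b * N : ℕ) : ℝ)) ^ (a * M))
      fun T hT => ?_).trans (by simp [𝒯])
    have hTc := (Finset.mem_powersetCard.1 hT).2
    have := measureReal_forall_best_subset_le hg M A (T := T) (by omega)
    rwa [hTc, (Finset.mem_powersetCard.1 hA).2] at this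
  refine (Finset.sum_le_card_nsmul _ _ _ hA).trans ?_
  simp [mul_assoc]

end Probability

/-! ### Estimating the terms of the union bound. -/

section Numerics

/-- The union bound for `a` users whose best channels all lie in a set of `b * a - 1` channels. -/
noncomputable def hallTerm (b N M a : ℕ) : ℝ :=
  (N.choose a : ℝ) * ((b * N).choose (b * a - 1)) *
    (((b * a - 1 : ℕ) : ℝ) / ((b * N : ℕ) : ℝ)) ^ (a * M)

lemma pow_le_exp_of_le_exp {x c m : ℝ} {a M : ℕ} (hx : 0 ≤ x) (hc : 0 ≤ c)
    (hxc : x ≤ Real.exp (-c)) (hm : m ≤ M) : x ^ (a * M) ≤ Real.exp (-(c * a * m)) := by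
  calc x ^ (a * M) ≤ Real.exp (-c) ^ (a * M) := by gcongr
    _ = Real.exp (-(c * a * M)) := by
      rw [← Real.exp_nat_mul]
      congr 1
      push_cast
      ring
    _ ≤ _ := by gcongr

lemma choose_le_exp_mul_log {n r : ℕ} {K s : ℝ} (hn : (n : ℝ) ≤ K) (hK : 1 ≤ K)
    (hrs : (r : ℝ) ≤ s) : (n.choose r : ℝ) ≤ Real.exp (s * Real.log K) := by
  calc (n.choose r : ℝ) ≤ (n : ℝ) ^ r := by exact_mod_cast Nat.choose_le_pow n r
    _ ≤ K ^ r := by gcongr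
    _ = Real.exp (r * Real.log K) := by
      rw [Real.exp_nat_mul, Real.exp_log (by linarith)]
    _ ≤ _ := by
      have := Real.log_nonneg hK
      gcongr

lemma choose_le_exp (n r : ℕ) : (n.choose r : ℝ) ≤ Real.exp n := by
  calc (n.choose r : ℝ) ≤ (2 : ℝ) ^ n := by exact_mod_cast Nat.choose_le_two_pow n r
    _ ≤ Real.exp 1 ^ n := by
      gcongr
      linarith [Real.add_one_le_exp 1]
    _ = _ := by rw [← Real.exp_nat_mul, mul_one]

lemma one_div_rpow_eq_exp {x : ℝ} (hx : 0 < x) (p : ℝ) :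
    1 / x ^ p = Real.exp (-(p * Real.log x)) := by
  rw [one_div, ← Real.rpow_neg hx.le, Real.rpow_def_of_pos hx]
  congr 1
  ring

variable {b N M : ℕ} {ε : ℝ}

/-- The term is `K (1 - 1/K)^(NM) ≤ K exp(-M/b)`, and `1 - (b+1)(1+ε)/b = -(ε + (ε+1)/b)`. -/
lemma hallTerm_self_le (hb : 1 ≤ b) (hN : 1 ≤ N)
    (hM : ((b : ℝ) + 1) * (1 + ε) * Real.log ((b * N : ℕ) : ℝ) ≤ (M : ℝ)) :
    hallTerm b N M N ≤ 1 / ((b * N : ℕ) : ℝ) ^ (ε + (ε + 1) / (b : ℝ)) := by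
  have hK : 1 ≤ b * N := Nat.mul_pos hb hN
  set K := b * N with hKdef
  have hKr : (1 : ℝ) ≤ (K : ℝ) := by exact_mod_cast hK
  have hbr : (1 : ℝ) ≤ b := by exact_mod_cast hb
  have hNr : (1 : ℝ) ≤ N := by exact_mod_cast hN
  have hKbN : (K : ℝ) = b * N := by rw [hKdef]; push_cast; ring
  have hch : K.choose (K - 1) = K := by
    rw [Nat.choose_symm hK, Nat.choose_one_right]
  have hx : ((K - 1 : ℕ) : ℝ) / (K : ℝ) ≤ Real.exp (-(1 / (K : ℝ))) := by
    have := Real.add_one_le_exp (-(1 / (K : ℝ)))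
    rw [Nat.cast_sub hK, Nat.cast_one, sub_div, div_self (by positivity)]
    linarith
  have hpow := pow_le_exp_of_le_exp (a := N) (by positivity) (by positivity) hx hM
  unfold hallTerm
  rw [← hKdef, Nat.choose_self, hch]
  calc ((1 : ℕ) : ℝ) * K * (((K - 1 : ℕ) : ℝ) / (K : ℝ)) ^ (N * M)
      ≤ ((1 : ℕ) : ℝ) * K * Real.exp (-(1 / (K : ℝ) * N *
        (((b : ℝ) + 1) * (1 + ε) * Real.log (K : ℝ)))) := by gcongr
    _ = Real.exp (Real.log K) * Real.exp (-(1 / (K : ℝ) * N *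
        (((b : ℝ) + 1) * (1 + ε) * Real.log (K : ℝ)))) := by
      rw [Real.exp_log (by linarith)]
      simp
    _ = _ := by
      have h1 : 1 / (K : ℝ) * N = 1 / b := by
        rw [hKbN]
        field_simp
      rw [one_div_rpow_eq_exp (by linarith), ← Real.exp_add, h1]
      congr 1
      field_simp
      ring

/-- With `L = log K`, the binomials cost `(b+1) a L` in the exponent, while the power gains at least
`3 (b+1)(1+ε) a L` because the base is at most `exp (-3)`. -/
lemma hallTerm_le_of_le_exp_neg_three {a : ℕ} (hε : 0 < ε) (hb : 1 ≤ b) (ha : 1 ≤ a)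
    (haN : (a : ℝ) ≤ Real.exp (-3) * N)
    (hM : ((b : ℝ) + 1) * (1 + ε) * Real.log ((b * N : ℕ) : ℝ) ≤ (M : ℝ)) :
    hallTerm b N M a ≤ Real.exp (-((2 + 3 * ε) * Real.log ((b * N : ℕ) : ℝ))) := by
  have hN : 1 ≤ N := by
    rcases Nat.eq_zero_or_pos N with h | h
    · subst h
      have : (1 : ℝ) ≤ a := by exact_mod_cast ha
      norm_num at haN
      linarith
    · exact h
  have hK : 1 ≤ b * N := Nat.mul_pos hb hN
  have hba : 1 ≤ b * a := Nat.mul_pos hb ha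
  set K := b * N with hKdef
  have hKr : (1 : ℝ) ≤ (K : ℝ) := by exact_mod_cast hK
  have hbr : (1 : ℝ) ≤ b := by exact_mod_cast hb
  have hNr : (1 : ℝ) ≤ N := by exact_mod_cast hN
  have har : (1 : ℝ) ≤ a := by exact_mod_cast ha
  have hKbN : (K : ℝ) = b * N := by rw [hKdef]; push_cast; ring
  have hL : 0 ≤ Real.log K := Real.log_nonneg hKr
  have hx : ((b * a - 1 : ℕ) : ℝ) / (K : ℝ) ≤ Real.exp (-3) := by
    rw [div_le_iff₀ (by linarith), Nat.cast_sub hba, hKbN]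
    push_cast
    nlinarith
  have hpow := pow_le_exp_of_le_exp (a := a) (by positivity) (by norm_num) hx hM
  have h1 : (N.choose a : ℝ) ≤ Real.exp (a * Real.log K) :=
    choose_le_exp_mul_log (by rw [hKbN]; nlinarith) hKr le_rfl
  have h2 : (K.choose (b * a - 1) : ℝ) ≤ Real.exp (b * a * Real.log K) :=
    choose_le_exp_mul_log le_rfl hKr (by rw [Nat.cast_sub hba]; push_cast; linarith)
  unfold hallTerm
  rw [← hKdef]
  calc _ ≤ Real.exp (a * Real.log K) * Real.exp (b * a * Real.log K) *
        Real.exp (-(3 * a * (((b : ℝ) + 1) * (1 + ε) * Real.log (K : ℝ)))) := by gcongr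
    _ = Real.exp (-(((b : ℝ) + 1) * a * (2 + 3 * ε) * Real.log K)) := by
      rw [← Real.exp_add, ← Real.exp_add]
      congr 1
      ring
    _ ≤ _ := by
      have : (1 : ℝ) ≤ ((b : ℝ) + 1) * a := by nlinarith
      have h3 : 0 ≤ (2 + 3 * ε) * Real.log K := by positivity
      gcongr
      nlinarith

/-- Here the binomials cost only `O(N)` in the exponent, whereas the power gains order `N * M`, with
`M` at least of order `log K` in the application. -/
lemma hallTerm_le_of_exp_neg_three_le {a : ℕ} {δ : ℝ} (hδ : 0 ≤ δ) (hb : 1 ≤ b) (ha : 1 ≤ a)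
    (haN : Real.exp (-3) * N ≤ a) (haδ : a ≤ (1 - δ) * N) :
    hallTerm b N M a ≤ Real.exp (((b : ℝ) + 1) * N - δ * Real.exp (-3) * N * M) := by
  have hba : 1 ≤ b * a := Nat.mul_pos hb ha
  have hbr : (1 : ℝ) ≤ b := by exact_mod_cast hb
  have har : (1 : ℝ) ≤ a := by exact_mod_cast ha
  have hN : 1 ≤ N := by
    rcases Nat.eq_zero_or_pos N with h | h
    · subst h
      norm_num at haδ
      omega
    · exact h
  have hNr : (1 : ℝ) ≤ N := by exact_mod_cast hN
  have hx : ((b * a - 1 : ℕ) : ℝ) / ((b * N : ℕ) : ℝ) ≤ Real.exp (-δ) := by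
    have h1 := Real.add_one_le_exp (-δ)
    refine le_trans ?_ h1
    rw [div_le_iff₀ (by push_cast; positivity), Nat.cast_sub hba]
    push_cast
    nlinarith
  have hpow := pow_le_exp_of_le_exp (a := a) (by positivity) hδ hx (le_refl (M : ℝ))
  have h1 := choose_le_exp N a
  have h2 := choose_le_exp (b * N) (b * a - 1)
  unfold hallTerm
  calc _ ≤ Real.exp N * Real.exp ((b * N : ℕ) : ℝ) * Real.exp (-(δ * a * M)) := by gcongr
    _ = Real.exp (((b : ℝ) + 1) * N - δ * a * M) := by
      rw [← Real.exp_add, ← Real.exp_add]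
      congr 1
      push_cast
      ring
    _ ≤ _ := by
      have : δ * (Real.exp (-3) * N) * M ≤ δ * a * M := by gcongr
      refine Real.exp_le_exp.2 ?_
      linarith

/-- Reflecting the binomials to `N.choose d` and `K.choose (b*d+1)` makes their cost linear in the
deficit `d`. The value at `d = 1` gives the prefactor; each further unit of `d` contributes one
geometric factor. -/
lemma hallTerm_le_of_near {a d : ℕ} (hε : 0 < ε) (hb : 1 ≤ b) (ha : 1 ≤ a) (hd : 1 ≤ d)
    (had : a + d = N) (hdδ : (1 + 3 / 4 * ε) * N ≤ (1 + ε) * a)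
    (hM : ((b : ℝ) + 1) * (1 + ε) * Real.log ((b * N : ℕ) : ℝ) ≤ (M : ℝ)) :
    hallTerm b N M a ≤
      Real.exp (-((3 / 2 * ε + (3 / 2 * ε + 1) / (b : ℝ)) * Real.log ((b * N : ℕ) : ℝ))) *
      Real.exp (-(3 / 4 * ε * (b + 1) * Real.log ((b * N : ℕ) : ℝ))) ^ (d - 1) := by
  have hN : 1 ≤ N := by omega
  have hK : 1 ≤ b * N := Nat.mul_pos hb hN
  have hba : 1 ≤ b * a := Nat.mul_pos hb ha
  have hKad : b * N = b * a - 1 + (b * d + 1) := by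
    rw [← had, mul_add]
    omega
  have hch1 : N.choose a = N.choose d := by
    rw [← had, Nat.choose_symm_add]
  have hch2 : (b * N).choose (b * a - 1) = (b * N).choose (b * d + 1) := by
    rw [hKad, Nat.choose_symm_add]
  unfold hallTerm
  rw [hch1, hch2]
  set K := b * N with hKdef
  have hKr : (1 : ℝ) ≤ (K : ℝ) := by exact_mod_cast hK
  have hbr : (1 : ℝ) ≤ b := by exact_mod_cast hb
  have hNr : (1 : ℝ) ≤ N := by exact_mod_cast hN
  have hdr : (1 : ℝ) ≤ d := by exact_mod_cast hd
  have hKbN : (K : ℝ) = b * N := by rw [hKdef]; push_cast; ring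
  have hL : 0 ≤ Real.log K := Real.log_nonneg hKr
  have hadr : (a : ℝ) + d = N := by exact_mod_cast had
  have hx : ((b * a - 1 : ℕ) : ℝ) / (K : ℝ) ≤ Real.exp (-((b * d + 1) / (K : ℝ))) := by
    refine le_trans (le_of_eq ?_) (Real.add_one_le_exp _)
    rw [Nat.cast_sub hba]
    push_cast
    field_simp
    rw [hKbN, ← hadr]
    ring
  have hpow := pow_le_exp_of_le_exp (a := a) (by positivity) (by positivity) hx hM
  have h1 : (N.choose d : ℝ) ≤ Real.exp (d * Real.log K) :=
    choose_le_exp_mul_log (by rw [hKbN]; nlinarith) hKr le_rfl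
  have h2 : (K.choose (b * d + 1) : ℝ) ≤ Real.exp ((b * d + 1) * Real.log K) :=
    choose_le_exp_mul_log le_rfl hKr (by push_cast; linarith)
  calc _ ≤ Real.exp (d * Real.log K) * Real.exp ((b * d + 1) * Real.log K) *
        Real.exp (-((b * d + 1) / (K : ℝ) * a *
          (((b : ℝ) + 1) * (1 + ε) * Real.log (K : ℝ)))) := by gcongr
    _ = Real.exp ((d + (b * d + 1) - (b * d + 1) * (b + 1) / b * ((1 + ε) * a / N))
          * Real.log K) := by
      rw [← Real.exp_add, ← Real.exp_add, hKbN]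
      congr 1
      field_simp
      ring
    _ ≤ Real.exp ((d + (b * d + 1) - (b * d + 1) * (b + 1) / b * (1 + 3 / 4 * ε))
          * Real.log K) := by
      have : 1 + 3 / 4 * ε ≤ (1 + ε) * a / N := by
        rwa [le_div_iff₀ (by linarith)]
      gcongr
    _ ≤ Real.exp ((-(3 / 2 * ε + (3 / 2 * ε + 1) / (b : ℝ))
          - (d - 1) * (3 / 4 * ε * (b + 1))) * Real.log K) := by
      have hcoef : d + (b * d + 1) - (b * d + 1) * (b + 1) / b * (1 + 3 / 4 * ε)
          ≤ -(3 / 2 * ε + (3 / 2 * ε + 1) / (b : ℝ)) - ((d : ℝ) - 1) * (3 / 4 * ε * (b + 1)) := by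
        have hib : 1 / (b : ℝ) ≤ b := by
          rw [div_le_iff₀ (by linarith)]
          nlinarith
        -- Both exponents have the same slope in `d`, so the slack is independent of `d`; it
        -- vanishes for `b = 1`.
        have hid : -(3 / 2 * ε + (3 / 2 * ε + 1) / (b : ℝ)) - ((d : ℝ) - 1) * (3 / 4 * ε * (b + 1))
            - (d + (b * d + 1) - (b * d + 1) * (b + 1) / b * (1 + 3 / 4 * ε))
            = 3 / 4 * ε * (b - 1 / b) := by
          field_simp
          ring
        have : 0 ≤ 3 / 4 * ε * (b - 1 / (b : ℝ)) := by
          have := sub_nonneg.2 hib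
          positivity
        linarith
      gcongr
    _ = _ := by
      rw [← Real.exp_nat_mul, ← Real.exp_add, Nat.cast_sub hd]
      congr 1
      push_cast
      ring

lemma sum_pow_reflect_le_two {q : ℝ} (hq : 0 ≤ q) (hq2 : q ≤ 1 / 2) (n : ℕ) :
    ∑ a ∈ Finset.Ico 1 n, q ^ (n - 1 - a) ≤ 2 := by
  calc ∑ a ∈ Finset.Ico 1 n, q ^ (n - 1 - a) ≤ ∑ a ∈ Finset.range n, q ^ (n - 1 - a) := by
        refine Finset.sum_le_sum_of_subset_of_nonneg ?_ fun _ _ _ => by positivity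
        intro a ha
        exact Finset.mem_range.2 (Finset.mem_Ico.1 ha).2
    _ = ∑ j ∈ Finset.range n, q ^ j := Finset.sum_range_reflect (fun j => q ^ j) n
    _ ≤ ∑' j, q ^ j := (summable_geometric_of_lt_one hq (by linarith)).sum_le_tsum _
        fun _ _ => by positivity
    _ = (1 - q)⁻¹ := tsum_geometric_of_lt_one hq (by linarith)
    _ ≤ 2 := by
      rw [inv_le_comm₀ (by linarith) (by norm_num)]
      linarith

lemma three_le_pi_mul_sqrt_mul_exp_three (hb : 1 ≤ b) :
    3 ≤ Real.pi * Real.sqrt b * Real.exp 3 / 12 := by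
  have h1 : (1 : ℝ) ≤ Real.sqrt b := by
    rw [Real.one_le_sqrt]
    exact_mod_cast hb
  have h2 : (12 : ℝ) ≤ Real.exp 3 := by
    have he : Real.exp 3 = Real.exp 1 ^ 3 := by
      rw [← Real.exp_nat_mul]
      norm_num
    have h := Real.exp_one_gt_d9
    rw [he]
    calc (12 : ℝ) ≤ 2.7182818283 ^ 3 := by norm_num
      _ ≤ _ := by gcongr
  have h3 := Real.pi_gt_three
  have h4 : (3 : ℝ) ≤ Real.pi * Real.sqrt b := by nlinarith
  nlinarith

lemma exists_forall_sum_hallTerm_le (hb : 1 ≤ b) (hε : 0 < ε) :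
    ∃ K₀ : ℕ, ∀ N M : ℕ, K₀ ≤ b * N →
      ((b : ℝ) + 1) * (1 + ε) * Real.log ((b * N : ℕ) : ℝ) ≤ (M : ℝ) →
      ∑ a ∈ Finset.Icc 1 N, hallTerm b N M a ≤
          1 / ((b * N : ℕ) : ℝ) ^ (ε + (ε + 1) / (b : ℝ)) +
          Real.pi * Real.sqrt b * Real.exp 3 / 12 *
            (1 / ((b * N : ℕ) : ℝ) ^ (3 / 2 * ε + (3 / 2 * ε + 1) / (b : ℝ))) := by
  -- Chosen so that `(1 + ε) * (1 - δ) = 1 + 3/4 * ε`, the threshold of `hallTerm_le_of_near`.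
  set δ : ℝ := ε / 4 / (1 + ε) with hδdef
  have hδ : 0 < δ := by positivity
  have hlog : Tendsto (fun K : ℕ => Real.log K) atTop atTop :=
    Real.tendsto_log_atTop.comp tendsto_natCast_atTop_atTop
  have hlin : ∀ᶠ K : ℕ in atTop, (2 + 3 * ε) * Real.log K ≤ K := by
    have h := (Real.isLittleO_log_id_atTop.bound (c := 1 / (2 + 3 * ε)) (by positivity))
    filter_upwards [tendsto_natCast_atTop_atTop.eventually h] with K hK
    have h1 : Real.log K ≤ 1 / (2 + 3 * ε) * K := by
      refine (le_abs_self _).trans ?_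
      simpa using hK
    calc (2 + 3 * ε) * Real.log K ≤ (2 + 3 * ε) * (1 / (2 + 3 * ε) * K) := by gcongr
      _ = K := by field_simp
  -- The second bound on `log K` makes the power in the middle range gain twice what the binomials
  -- cost, leaving at most `exp (-K)`, which `hlin` compares with `K^(-(2+3ε))`. The last bound
  -- makes the geometric ratio at most `1/2`, and `K ≥ 1` forces `N ≥ 1`.
  obtain ⟨K₀, hK₀⟩ := eventually_atTop.1 ((hlin.and (eventually_ge_atTop 1)).and
    ((hlog.eventually_ge_atTop (2 / (δ * Real.exp (-3) * (1 + ε)))).and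
      (hlog.eventually_ge_atTop (Real.log 2 / (3 / 4 * ε * (b + 1))))))
  refine ⟨K₀, fun N M hKN hM => ?_⟩
  obtain ⟨⟨hK1, hK⟩, hK2, hK3⟩ := hK₀ _ hKN
  have hN : 1 ≤ N := by
    rcases Nat.eq_zero_or_pos N with h | h
    · simp [h] at hK
    · exact h
  have hbr : (1 : ℝ) ≤ b := by exact_mod_cast hb
  have hNr : (1 : ℝ) ≤ N := by exact_mod_cast hN
  have hKr : (1 : ℝ) ≤ ((b * N : ℕ) : ℝ) := by exact_mod_cast hK
  have hKbN : ((b * N : ℕ) : ℝ) = b * N := by push_cast; ring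
  have hL := Real.log_nonneg hKr
  rw [div_le_iff₀ (by positivity)] at hK2 hK3
  set L := Real.log ((b * N : ℕ) : ℝ) with hLdef
  set P : ℝ := 3 / 2 * ε + (3 / 2 * ε + 1) / (b : ℝ) with hP
  set q : ℝ := Real.exp (-(3 / 4 * ε * (b + 1) * L)) with hq
  have hPle : P + 1 ≤ 2 + 3 * ε := by
    have : (3 / 2 * ε + 1) / (b : ℝ) ≤ 3 / 2 * ε + 1 := div_le_self (by positivity) hbr
    linarith
  have hq2 : q ≤ 1 / 2 := by
    have h2 : (1 / 2 : ℝ) = Real.exp (-Real.log 2) := by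
      rw [Real.exp_neg, Real.exp_log (by norm_num)]
      norm_num
    rw [h2, hq]
    gcongr
    linarith
  -- One bound for all three ranges: summed over `a`, the flat part gives at most `N K^(-P-1) ≤
  -- K^(-P)` and the geometric part at most `2 K^(-P)`.
  have hterm : ∀ a ∈ Finset.Ico 1 N, hallTerm b N M a ≤
      Real.exp (-(P + 1) * L) + Real.exp (-(P * L)) * q ^ (N - 1 - a) := by
    intro a ha
    obtain ⟨ha1, haN⟩ := Finset.mem_Ico.1 ha
    have hmain : Real.exp (-((2 + 3 * ε) * L)) ≤
        Real.exp (-(P + 1) * L) + Real.exp (-(P * L)) * q ^ (N - 1 - a) := by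
      have h1 : Real.exp (-((2 + 3 * ε) * L)) ≤ Real.exp (-(P + 1) * L) := by
        rw [← neg_mul]
        gcongr
      have h2 : 0 ≤ Real.exp (-(P * L)) * q ^ (N - 1 - a) := by positivity
      linarith
    by_cases hs : (a : ℝ) ≤ Real.exp (-3) * N
    · exact (hallTerm_le_of_le_exp_neg_three hε hb ha1 hs hM).trans hmain
    by_cases hmid : (a : ℝ) ≤ (1 - δ) * N
    · refine (hallTerm_le_of_exp_neg_three_le hδ.le hb ha1 (not_le.1 hs).le hmid).trans
        (le_trans ?_ hmain)
      have h1 : δ * Real.exp (-3) * N * ((b + 1) * (1 + ε) * L) ≤ δ * Real.exp (-3) * N * M := by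
        gcongr
      have h2 : 2 * (((b : ℝ) + 1) * N) ≤ L * (δ * Real.exp (-3) * (1 + ε)) * ((b + 1) * N) := by
        gcongr
      rw [hKbN] at hK1
      gcongr
      nlinarith
    · push Not at hmid
      have hnear : (1 + 3 / 4 * ε) * N ≤ (1 + ε) * a := by
        have : (1 + ε) * ((1 - δ) * N) = (1 + 3 / 4 * ε) * N := by
          rw [hδdef]
          field_simp
          ring
        rw [← this]
        gcongr
      refine (hallTerm_le_of_near (d := N - a) hε hb ha1 (by omega) (by omega) hnear hM).trans ?_
      rw [show N - a - 1 = N - 1 - a by omega]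
      have : 0 ≤ Real.exp (-(P + 1) * L) := by positivity
      linarith
  have hPexp : 1 / ((b * N : ℕ) : ℝ) ^ P = Real.exp (-(P * L)) :=
    one_div_rpow_eq_exp (by linarith) P
  have hconst : N * Real.exp (-(P + 1) * L) ≤ Real.exp (-(P * L)) := by
    have h1 : Real.exp (-(P + 1) * L) = Real.exp (-(P * L)) * ((b * N : ℕ) : ℝ)⁻¹ := by
      rw [← Real.exp_log (show (0 : ℝ) < ((b * N : ℕ) : ℝ) by linarith), ← Real.exp_neg,
        ← Real.exp_add, ← hLdef]
      congr 1
      ring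
    have h2 : (N : ℝ) * ((b * N : ℕ) : ℝ)⁻¹ ≤ 1 := by
      rw [← div_eq_mul_inv, div_le_one (by linarith), hKbN]
      nlinarith
    rw [h1]
    calc N * (Real.exp (-(P * L)) * ((b * N : ℕ) : ℝ)⁻¹)
        = Real.exp (-(P * L)) * (N * ((b * N : ℕ) : ℝ)⁻¹) := by ring
      _ ≤ Real.exp (-(P * L)) * 1 := by gcongr
      _ = _ := mul_one _
  have hrest : ∑ a ∈ Finset.Ico 1 N, hallTerm b N M a ≤ 3 * Real.exp (-(P * L)) := by
    refine (Finset.sum_le_sum hterm).trans ?_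
    rw [Finset.sum_add_distrib, ← Finset.mul_sum, Finset.sum_const, Nat.card_Ico, nsmul_eq_mul]
    have h1 : ((N - 1 : ℕ) : ℝ) * Real.exp (-(P + 1) * L) ≤ N * Real.exp (-(P + 1) * L) := by
      gcongr
      omega
    have h2 := mul_le_mul_of_nonneg_left
      (sum_pow_reflect_le_two (Real.exp_pos _).le hq2 N) (Real.exp_pos (-(P * L))).le
    linarith
  rw [← Finset.Ico_add_one_right_eq_Icc, Finset.sum_Ico_succ_top hN, add_comm, hPexp]
  refine add_le_add (hallTerm_self_le hb hN hM) (hrest.trans ?_)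
  have := three_le_pi_mul_sqrt_mul_exp_three hb
  gcongr

end Numerics

/-! ### Limits, summability, and Borel–Cantelli. -/

section Limits

lemma tendsto_one_div_mul_rpow {b : ℕ} (hb : 1 ≤ b) {s t c : ℝ} (hs : 0 < s) (ht : 0 < t) :
    Tendsto (fun N : ℕ => 1 / ((b * N : ℕ) : ℝ) ^ s + c * (1 / ((b * N : ℕ) : ℝ) ^ t))
      atTop (𝓝 0) := by
  have hbN : Tendsto (fun N : ℕ => ((b * N : ℕ) : ℝ)) atTop atTop :=
    tendsto_natCast_atTop_atTop.comp (tendsto_id.const_mul_atTop' hb)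
  have h : ∀ {r : ℝ}, 0 < r → Tendsto (fun N : ℕ => 1 / ((b * N : ℕ) : ℝ) ^ r) atTop (𝓝 0) := by
    intro r hr
    simp only [one_div]
    exact ((tendsto_rpow_atTop hr).comp hbN).inv_tendsto_atTop
  simpa using (h hs).add ((h ht).const_mul c)

lemma summable_one_div_mul_rpow {b : ℕ} {s t c : ℝ} (hs : 1 < s) (ht : 1 < t) :
    Summable (fun N : ℕ => 1 / ((b * N : ℕ) : ℝ) ^ s + c * (1 / ((b * N : ℕ) : ℝ) ^ t)) := by
  have h : ∀ {r : ℝ}, 1 < r → Summable (fun N : ℕ => 1 / ((b * N : ℕ) : ℝ) ^ r) := by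
    intro r hr
    have h1 := (Real.summable_one_div_nat_rpow.2 hr).mul_left (1 / (b : ℝ) ^ r)
    refine h1.congr fun N => ?_
    push_cast
    rw [Real.mul_rpow (by positivity) (by positivity), one_div_mul_one_div]
  exact (h hs).add ((h ht).mul_left c)

/-- First Borel–Cantelli lemma: almost surely only finitely many `E n` occur. No independence is
required, hence the arbitrary coupling between different `N`. -/
lemma ae_tendsto_indicator_of_summable {Ω : Type*} [MeasurableSpace Ω] {μ : Measure Ω}
    [IsFiniteMeasure μ] {E : ℕ → Set Ω} (h : Summable fun n => μ.real (E n)) :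
    ∀ᵐ ω ∂μ, Tendsto (fun n => (E n).indicator (fun _ => (1 : ℝ)) ω) atTop (𝓝 0) := by
  have hfin : ∑' n, μ (E n) ≠ ⊤ := by
    have : ∀ n, μ (E n) = ENNReal.ofReal (μ.real (E n)) := fun n => by simp
    simp_rw [this]
    exact h.tsum_ofReal_ne_top
  filter_upwards [ae_eventually_notMem hfin] with ω hω
  refine tendsto_const_nhds.congr' ?_
  filter_upwards [hω] with n hn
  rw [Set.indicator_of_notMem hn]

end Limits

theorem theorem1 (b : ℕ) (hb : 1 ≤ b) (ε : ℝ) (hε : 0 < ε) :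
    (∃ K₀ : ℕ, ∀ N M : ℕ, K₀ ≤ b * N →
      ((b : ℝ) + 1) * (1 + ε) * Real.log ((b * N : ℕ) : ℝ) ≤ (M : ℝ) →
      ∀ (Ω : Type*) [MeasurableSpace Ω] (μ : Measure Ω) [IsProbabilityMeasure μ]
        (g : Fin N → Fin (b * N) → Ω → ℝ), IsChannelGains μ g →
        μ.real (noPMEvent b N M g) ≤
          1 / ((b * N : ℕ) : ℝ) ^ (ε + (ε + 1) / (b : ℝ)) +
          Real.pi * Real.sqrt b * Real.exp 3 / 12 *
            (1 / ((b * N : ℕ) : ℝ) ^ (3 / 2 * ε + (3 / 2 * ε + 1) / (b : ℝ)))) ∧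
    (∀ (Ω : Type*) [MeasurableSpace Ω] (μ : Measure Ω) [IsProbabilityMeasure μ]
        (M : ℕ → ℕ) (g : (N : ℕ) → Fin N → Fin (b * N) → Ω → ℝ),
      (∀ᶠ N in atTop,
        ((b : ℝ) + 1) * (1 + ε) * Real.log ((b * N : ℕ) : ℝ) ≤ (M N : ℝ)) →
      (∀ N, IsChannelGains μ (g N)) →
      Tendsto (fun N => μ.real (noPMEvent b N (M N) (g N))) atTop (𝓝 0) ∧
      Tendsto (fun N => μ.real {ω | HasPM b N (M N) (fun n k => g N n k ω)}) atTop (𝓝 1) ∧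
      (1 ≤ ε → ∀ᵐ ω ∂μ,
        Tendsto (fun N => (noPMEvent b N (M N) (g N)).indicator (fun _ => (1 : ℝ)) ω)
          atTop (𝓝 0))) :=
 by
  obtain ⟨K₀, hK₀⟩ := exists_forall_sum_hallTerm_le (ε := ε) hb hε
  have hbpos : (0 : ℝ) < b := by exact_mod_cast hb
  refine ⟨⟨K₀, fun N M hKN hM Ω _ μ _ g hg =>
    (measureReal_noPMEvent_le hb M hg).trans (hK₀ N M hKN hM)⟩, ?_⟩
  intro Ω _ μ _ M g hM hg
  have hbound : ∀ᶠ N in atTop, μ.real (noPMEvent b N (M N) (g N)) ≤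
      1 / ((b * N : ℕ) : ℝ) ^ (ε + (ε + 1) / (b : ℝ)) +
      Real.pi * Real.sqrt b * Real.exp 3 / 12 *
        (1 / ((b * N : ℕ) : ℝ) ^ (3 / 2 * ε + (3 / 2 * ε + 1) / (b : ℝ))) := by
    filter_upwards [hM, eventually_ge_atTop K₀] with N hMN hN
    exact (measureReal_noPMEvent_le hb _ (hg N)).trans
      (hK₀ N (M N) (hN.trans (Nat.le_mul_of_pos_left N hb)) hMN)
  have hlim : Tendsto (fun N => μ.real (noPMEvent b N (M N) (g N))) atTop (𝓝 0) :=
    tendsto_of_tendsto_of_tendsto_of_le_of_le' tendsto_const_nhds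
      (tendsto_one_div_mul_rpow hb (by positivity) (by positivity))
      (Eventually.of_forall fun _ => measureReal_nonneg) hbound
  refine ⟨hlim, ?_, fun hε1 => ?_⟩
  · refine tendsto_of_tendsto_of_tendsto_of_le_of_le
      (g := fun N => 1 - μ.real (noPMEvent b N (M N) (g N))) (h := fun _ => 1)
      (by simpa using hlim.const_sub 1) tendsto_const_nhds (fun N => ?_)
      fun N => measureReal_le_one
    -- Subadditivity alone gives the lower bound, so neither event has to be shown measurable.
    have hcover : (Set.univ : Set Ω) = {ω | HasPM b N (M N) (fun n k => g N n k ω)} ∪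
        noPMEvent b N (M N) (g N) := by
      ext ω
      simp [noPMEvent, em]
    have h := measureReal_union_le (μ := μ) {ω | HasPM b N (M N) (fun n k => g N n k ω)}
      (noPMEvent b N (M N) (g N))
    rw [← hcover, probReal_univ] at h
    change 1 - μ.real (noPMEvent b N (M N) (g N)) ≤ _
    linarith
  · refine ae_tendsto_indicator_of_summable ?_
    -- The positive `1/b` part keeps the exponent strictly above `1` even at `ε = 1`.
    have hs : 1 < ε + (ε + 1) / (b : ℝ) := by
      have : 0 < (ε + 1) / (b : ℝ) := by positivity
      linarith
    have ht : 1 < 3 / 2 * ε + (3 / 2 * ε + 1) / (b : ℝ) := by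
      have : 0 < (3 / 2 * ε + 1) / (b : ℝ) := by positivity
      linarith
    refine summable_of_isBigO_nat (summable_one_div_mul_rpow (b := b)
      (c := Real.pi * Real.sqrt b * Real.exp 3 / 12) hs ht) (Asymptotics.IsBigO.of_bound 1 ?_)
    filter_upwards [hbound] with N hN
    rw [one_mul, Real.norm_of_nonneg measureReal_nonneg]
    exact hN.trans (le_abs_self _)
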